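/- **Theorem (Global convergence of gradient play to Nash equilibria in Markov potential games).** Consider an $n$-agent tabular Markov decision process with finite state space $\mathcal S$, finite action spaces $\mathcal A_1,\dots,\mathcal A_n$ (write $\mathcal A=\mathcal A_1\times\cdots\times\mathcal A_n$), transition probabilities $P(s'|s,a)$, rewards $r_i:\mathcal S\times\mathcal A\to[0,1]$, discount factor $\gamma\in[0,1)$ and initial state distribution $\rho$. A policy is a parameter $\theta=(\theta_1,\dots,\theta_n)\in\mathcal X=\mathcal X_1\times\cdots\times\mathcal X_n$, $\mathcal X_i=\Delta(\mathcal A_i)^{|\mathcal S|}$, with $\pi_\theta(a|s)=\prod_{i}\theta_{i,(s,a_i)}$. For $f:\mathcal S\times\mathcal A\to\mathbb R$ put $V_f^\theta(s)=\mathbb E\big[\sum_{t\ge 0}\gamma^t f(s_t,a_t)\,\big|\,\pi_\theta,\ s_0=s\big]$, and let $V_i^\theta=V_{r_i}^\theta$, $J_i(\theta)=\mathbb E_{s_0\sim\rho}V_i^\theta(s_0)$, and $d_\theta(s)=(1-\gamma)\,\mathbb E_{s_0\sim\rho}\sum_{t\ge0}\gamma^t\Pr^\theta(s_t=s\,|\,s_0)$.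 Let $$\text{NE-gap}(\theta)=\max_{i}\Big(\max_{\theta_i'\in\mathcal X_i}J_i(\theta_i',\theta_{-i})-J_i(\theta)\Big).$$ Assume: 1. $d_\theta(s)>0$ for all $s\in\mathcal S$ and $\theta\in\mathcal X$; 2. the process is a Markov potential game with potential function $\phi:\mathcal S\times\mathcal A\to\mathbb R$, that is, $V_i^{(\theta_i',\theta_{-i})}(s)-V_i^{(\theta_i,\theta_{-i})}(s)=V_\phi^{(\theta_i',\theta_{-i})}(s)-V_\phi^{(\theta_i,\theta_{-i})}(s)$ for every agent $i$, every state $s$, every $\theta\in\mathcal X$ and every $\theta_i'\in\mathcal X_i$; 3. the total potential function $\Phi(\theta)=\mathbb E_{s_0\sim\rho}V_\phi^\theta(s_0)$ satisfies $\Phi_{\min}\le\Phi(\theta)\le\Phi_{\max}$ for all $\theta\in\mathcal X$. Then the maximum $$M=\max_{\theta,\theta'\in\mathcal X}\ \max_{s\in\mathcal S}\ \frac{d_\theta(s)}{d_{\theta'}(s)}$$ exists. Moreover, let $\theta^{(0)}\in\mathcal X$ be arbitrary and run gradient play $$\theta_i^{(t+1)}=\mathrm{Proj}_{\mathcal X_i}\big(\theta_i^{(t)}+\eta\,\nabla_{\theta_i}J_i(\theta^{(t)})\big),\qquad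 i=1,\dots,n,\qquad \eta=\frac1\beta,\qquad \beta=\frac{2}{(1-\gamma)^3}\sum_{i=1}^n|\mathcal A_i|,$$ where $\mathrm{Proj}$ is the Euclidean projection and the gradient is taken in the coordinates $\theta_{i,(s,a_i)}$, $J_i$ being extended to a neighbourhood of $\mathcal X$ by its defining series. Then for every $\epsilon>0$ and every integer $T\ge1$ with $$T\ \ge\ \frac{64\,M^2\,(\Phi_{\max}-\Phi_{\min})\,|\mathcal S|\,\sum_{i=1}^n|\mathcal A_i|}{(1-\gamma)^3\,\epsilon^2}$$ one has $$\min_{1\le t\le T}\text{NE-gap}(\theta^{(t)})\ \le\ \epsilon .$$ -/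

import Mathlib

/-- The Euclidean projection of `u` onto a set `K`: a point of `K` nearest to `u`
(it exists and is unique if `K` is nonempty, closed and convex, which is the case in which it
is used below; if there is no nearest point, the value is `u`). -/
noncomputable def euclideanProj {E : Type*} [NormedAddCommGroup E] (K : Set E) (u : E) : E :=
  open Classical in
  if h : ∃ v ∈ K, ∀ w ∈ K, ‖u - v‖ ≤ ‖u - w‖ then h.choose else u

theorem euclideanProj_spec {E : Type*} [NormedAddCommGroup E] [InnerProductSpace ℝ E]
    {K : Set E} (hne : K.Nonempty) (hcomp : IsComplete K) (hconv : Convex ℝ K) (u : E) :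
    euclideanProj K u ∈ K ∧ ∀ w ∈ K, ‖u - euclideanProj K u‖ ≤ ‖u - w‖ := by
  have h : ∃ v ∈ K, ∀ w ∈ K, ‖u - v‖ ≤ ‖u - w‖ := by
    obtain ⟨v, hv, hmin⟩ := exists_norm_eq_iInf_of_complete_convex hne hcomp hconv u
    refine ⟨v, hv, fun w hw => ?_⟩
    rw [hmin]
    exact ciInf_le ⟨0, by rintro _ ⟨x, rfl⟩; exact norm_nonneg _⟩ (⟨w, hw⟩ : K)
  unfold euclideanProj
  rw [dif_pos h]
  exact h.choose_spec

/-- An `n`-agent tabular Markov decision process (stochastic game) with finite state space `S` and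
action space `A i` for agent `i`: transition probabilities `P s a s'` (the probability of moving to
`s'` from `s` under the joint action `a`), rewards `r i s a` in `[0,1]`, discount factor `γ` in
`[0,1)` and initial state distribution `ρ`. -/
structure MultiAgentMDP (n : ℕ) (S : Type*) (A : Fin n → Type*) [Fintype S] where
  P : S → (∀ i, A i) → S → ℝ
  P_mem : ∀ s a, P s a ∈ stdSimplex ℝ S
  r : Fin n → S → (∀ i, A i) → ℝ
  r_mem : ∀ i s a, r i s a ∈ Set.Icc (0 : ℝ) 1
  γ : ℝ
  γ_mem : γ ∈ Set.Ico (0 : ℝ) 1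
  ρ : S → ℝ
  ρ_mem : ρ ∈ stdSimplex ℝ S

/-- Parameters `θ = (θ_1, …, θ_n)`, where `θ_i` is a vector of the Euclidean space with
coordinates indexed by the pairs `(s, a_i)`. -/
abbrev PolicyParam {n : ℕ} (S : Type*) (A : Fin n → Type*) : Type _ :=
  ∀ i, EuclideanSpace ℝ (S × A i)

/-- The feasible region `X_i` of agent `i`: `θ_i (s, ·)` is a probability vector for every `s`. -/
def agentPolicies {n : ℕ} (S : Type*) (A : Fin n → Type*) [∀ i, Fintype (A i)] (i : Fin n) :
    Set (EuclideanSpace ℝ (S × A i)) :=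
  {x | ∀ s, (fun a : A i => x (s, a)) ∈ stdSimplex ℝ (A i)}

/-- The feasible region `X = X_1 × ⋯ × X_n`. -/
def jointPolicies {n : ℕ} (S : Type*) (A : Fin n → Type*) [∀ i, Fintype (A i)] :
    Set (PolicyParam S A) :=
  {θ | ∀ i, θ i ∈ agentPolicies S A i}

/-- The direct distributed parameterization `π_θ(a|s) = ∏ i, θ_{i,(s,a_i)}`. -/
def policyProb {n : ℕ} {S : Type*} {A : Fin n → Type*} (θ : PolicyParam S A) (s : S)
    (a : ∀ i, A i) : ℝ :=
  ∏ i, θ i (s, a i)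

namespace MultiAgentMDP

variable {n : ℕ} {S : Type*} {A : Fin n → Type*} [Fintype S] [DecidableEq S]
  [∀ i, Fintype (A i)]

/-- `G.stateProb θ t s₀ s` is the probability that `s_t = s` when `π_θ` is executed from `s₀`.
It is a polynomial in `θ`, and so is defined by the same formula for parameters off `X`; this is
what gives a meaning to gradients with respect to the coordinates of `θ`. -/
def stateProb (G : MultiAgentMDP n S A) (θ : PolicyParam S A) : ℕ → S → S → ℝ
  | 0, s₀, s => if s = s₀ then 1 else 0
  | t + 1, s₀, s' => ∑ s, G.stateProb θ t s₀ s * ∑ a, policyProb θ s a * G.P s a s'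

/-- The expected discounted sum `E[∑ₜ γ^t f(s_t, a_t) | π_θ, s_0 = s₀]` of a stage function `f`. -/
noncomputable def value (G : MultiAgentMDP n S A) (f : S → (∀ i, A i) → ℝ)
    (θ : PolicyParam S A) (s₀ : S) : ℝ :=
  ∑' t : ℕ, G.γ ^ t * ∑ s, G.stateProb θ t s₀ s * ∑ a, policyProb θ s a * f s a

/-- Agent `i`'s value function `V_i^θ`. -/
noncomputable def V (G : MultiAgentMDP n S A) (i : Fin n) (θ : PolicyParam S A) (s : S) : ℝ :=
  G.value (G.r i) θ s

/-- Agent `i`'s total reward `J_i(θ) = E_{s_0 ∼ ρ} V_i^θ(s_0)`. -/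
noncomputable def J (G : MultiAgentMDP n S A) (i : Fin n) (θ : PolicyParam S A) : ℝ :=
  ∑ s, G.ρ s * G.V i θ s

/-- The discounted state visitation distribution `d_θ` (with initial distribution `ρ`). -/
noncomputable def visitation (G : MultiAgentMDP n S A) (θ : PolicyParam S A) (s : S) : ℝ :=
  ∑ s₀, G.ρ s₀ * ((1 - G.γ) * ∑' t : ℕ, G.γ ^ t * G.stateProb θ t s₀ s)

/-- All the ratios `d_θ(s) / d_θ'(s)` for policies `θ, θ'` and states `s`. -/
def visitationRatios (G : MultiAgentMDP n S A) : Set ℝ :=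
  {x | ∃ θ ∈ jointPolicies S A, ∃ θ' ∈ jointPolicies S A, ∃ s : S,
    x = G.visitation θ s / G.visitation θ' s}

/-- The distribution mismatch coefficient `M = max_{θ, θ' ∈ X} ‖d_θ / d_θ'‖_∞`. -/
noncomputable def mismatch (G : MultiAgentMDP n S A) : ℝ :=
  sSup G.visitationRatios

/-- `G` is a Markov potential game with potential function `φ`. -/
def IsMarkovPotential (G : MultiAgentMDP n S A) (φ : S → (∀ i, A i) → ℝ) : Prop :=
  ∀ i, ∀ θ ∈ jointPolicies S A, ∀ x ∈ agentPolicies S A i, ∀ s,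
    G.V i (Function.update θ i x) s - G.V i θ s =
      G.value φ (Function.update θ i x) s - G.value φ θ s

/-- The total potential function `Φ(θ) = E_{s_0 ∼ ρ}[∑ₜ γ^t φ(s_t, a_t) | π_θ]`. -/
noncomputable def totalPotential (G : MultiAgentMDP n S A) (φ : S → (∀ i, A i) → ℝ)
    (θ : PolicyParam S A) : ℝ :=
  ∑ s, G.ρ s * G.value φ θ s

/-- `NE-gap_i(θ) = max_{θ_i' ∈ X_i} J_i(θ_i', θ_{-i}) - J_i(θ_i, θ_{-i})`. -/
noncomputable def agentNEGap (G : MultiAgentMDP n S A) (θ : PolicyParam S A) (i : Fin n) : ℝ :=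
  sSup ((fun x => G.J i (Function.update θ i x)) '' agentPolicies S A i) - G.J i θ

/-- `NE-gap(θ) = max_i NE-gap_i(θ)`. -/
noncomputable def NEGap (G : MultiAgentMDP n S A) (θ : PolicyParam S A) : ℝ :=
  ⨆ i, G.agentNEGap θ i

/-- The partial gradient `∇_{θ_i} J_i(θ)`, with respect to agent `i`'s own parameter. -/
noncomputable def policyGradient (G : MultiAgentMDP n S A) (θ : PolicyParam S A) (i : Fin n) :
    EuclideanSpace ℝ (S × A i) :=
  gradient (fun x => G.J i (Function.update θ i x)) (θ i)

/-- Gradient play with step size `η` started at `θ₀`: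
`θ_i^{(t+1)} = Proj_{X_i}(θ_i^{(t)} + η ∇_{θ_i} J_i(θ^{(t)}))` for all agents simultaneously. -/
noncomputable def gradientPlay (G : MultiAgentMDP n S A) (η : ℝ) (θ₀ : PolicyParam S A) :
    ℕ → PolicyParam S A
  | 0 => θ₀
  | t + 1 => fun i =>
      euclideanProj (agentPolicies S A i)
        (G.gradientPlay η θ₀ t i + η • G.policyGradient (G.gradientPlay η θ₀ t) i)

end MultiAgentMDP

-- Write `K_θ` for the state transition matrix and `N_θ = (1 - γ K_θ)⁻¹` for its Neumann series. In
-- the row-sum operator norm, `γ K_θ` has norm at most `γ`, also for signed parameters whose rows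
-- have ℓ¹ norm at most 1. Everything rests on the exact performance difference identity
-- `value_sub_value`. For a change of one agent it says that the gain is linear in the direction,
-- with occupation measure taken at the new parameter and action values at the old one. `gradForm`
-- keeps these two parameters separate; on the diagonal it is the policy gradient.
--
-- Ascent: let the agents move one after another. Each single move changes the potential by exactly
-- the change in that agent's own return, so only the rewards, bounded by 1, need estimates, and `φ`
-- needs none. Lipschitz bounds for `gradForm` make the total second-order loss at most half of what
-- the projection inequality guarantees to first order (`gradientPlay_ascent`). Hence the squared
-- step lengths have a sum of at most `2 (Φmax - Φmin) / β`.
--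
-- Stationarity: a short step leaves little first-order gain at its endpoint. Gradient domination
-- (`totalPotential_update_sub_le`) turns this into a small Nash gap, at the cost of the factor `M`
-- (`NEGap_gradientPlay_le`). The shortest of the first `T` steps proves the theorem.

attribute [local instance] Matrix.linftyOpNormedRing Matrix.linftyOpNormedAlgebra

/-- Parameters all of whose local components have `ℓ¹` norm at most `1`. -/
def subPolicies {n : ℕ} (S : Type*) (A : Fin n → Type*) [∀ i, Fintype (A i)] :
    Set (PolicyParam S A) :=
  {θ | ∀ i s, ∑ b, |θ i (s, b)| ≤ 1}

/-! ### Product policies in ℓ¹, and compactness of the feasible regions. -/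

section PolicyProb

variable {n : ℕ} {S : Type*} {A : Fin n → Type*}

theorem policyProb_update (θ : PolicyParam S A) (k : Fin n) (u : EuclideanSpace ℝ (S × A k))
    (s : S) (a : ∀ i, A i) :
    policyProb (Function.update θ k u) s a
      = u (s, a k) * ∏ i ∈ Finset.univ \ {k}, θ i (s, a i) := by
  unfold policyProb
  have h : ∀ i, (Function.update θ k u) i (s, a i)
      = Function.update (fun i => θ i (s, a i)) k (u (s, a k)) i := by
    intro i
    by_cases h : i = k
    · subst h; simp
    · simp [h]
  simp_rw [h]
  rw [Finset.prod_update_of_mem (Finset.mem_univ k)]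

theorem policyProb_update_sub (θ : PolicyParam S A) (k : Fin n)
    (u v : EuclideanSpace ℝ (S × A k)) (s : S) (a : ∀ i, A i) :
    policyProb (Function.update θ k (u - v)) s a
      = policyProb (Function.update θ k u) s a - policyProb (Function.update θ k v) s a := by
  simp only [policyProb_update, PiLp.sub_apply]; ring

theorem policyProb_update_add (θ : PolicyParam S A) (k : Fin n)
    (u v : EuclideanSpace ℝ (S × A k)) (s : S) (a : ∀ i, A i) :
    policyProb (Function.update θ k (u + v)) s a
      = policyProb (Function.update θ k u) s a + policyProb (Function.update θ k v) s a := by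
  simp only [policyProb_update, PiLp.add_apply]; ring

theorem policyProb_update_smul (θ : PolicyParam S A) (k : Fin n) (c : ℝ)
    (u : EuclideanSpace ℝ (S × A k)) (s : S) (a : ∀ i, A i) :
    policyProb (Function.update θ k (c • u)) s a
      = c * policyProb (Function.update θ k u) s a := by
  simp only [policyProb_update, PiLp.smul_apply, smul_eq_mul]; ring

variable [∀ i, Fintype (A i)]

theorem sum_abs_policyProb (θ : PolicyParam S A) (s : S) :
    ∑ a, |policyProb θ s a| = ∏ i, ∑ b, |θ i (s, b)| := by
  rw [Finset.prod_univ_sum, Fintype.piFinset_univ]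
  exact Finset.sum_congr rfl fun a _ => Finset.abs_prod _ _

theorem sum_abs_policyProb_le {θ : PolicyParam S A} (hθ : θ ∈ subPolicies S A) (s : S) :
    ∑ a, |policyProb θ s a| ≤ 1 := by
  rw [sum_abs_policyProb]
  exact Finset.prod_le_one (fun i _ => Finset.sum_nonneg fun _ _ => abs_nonneg _)
    fun i _ => hθ i s

theorem update_mem_subPolicies {θ : PolicyParam S A} (hθ : θ ∈ subPolicies S A) {k : Fin n}
    {u : EuclideanSpace ℝ (S × A k)} (hu : ∀ s, ∑ b, |u (s, b)| ≤ 1) :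
    Function.update θ k u ∈ subPolicies S A := by
  intro i s
  by_cases h : i = k
  · subst h; simpa using hu s
  · simpa [h] using hθ i s

theorem sum_abs_policyProb_update_le {θ : PolicyParam S A} (hθ : θ ∈ subPolicies S A) {k : Fin n}
    {u : EuclideanSpace ℝ (S × A k)} {c : ℝ} {s : S} (hu : ∑ b, |u (s, b)| ≤ c) :
    ∑ a, |policyProb (Function.update θ k u) s a| ≤ c := by
  rw [sum_abs_policyProb, ← Finset.mul_prod_erase _ _ (Finset.mem_univ k)]
  have h0 : 0 ≤ ∑ b, |u (s, b)| := Finset.sum_nonneg fun _ _ => abs_nonneg _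
  have h1 : ∏ i ∈ Finset.univ.erase k, ∑ b, |(Function.update θ k u) i (s, b)| ≤ 1 := by
    refine Finset.prod_le_one (fun i _ => Finset.sum_nonneg fun _ _ => abs_nonneg _) ?_
    intro i hi
    rw [Function.update_of_ne (Finset.ne_of_mem_erase hi)]
    exact hθ i s
  have h2 : 0 ≤ ∏ i ∈ Finset.univ.erase k, ∑ b, |(Function.update θ k u) i (s, b)| :=
    Finset.prod_nonneg fun i _ => Finset.sum_nonneg fun _ _ => abs_nonneg _
  simp only [Function.update_self]
  calc _ ≤ (∑ b, |u (s, b)|) * 1 := by gcongr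
    _ ≤ c := by simpa using hu

/-- Hybrid argument: replace the components one agent at a time. The product is linear in each
component, and the frozen factors have ℓ¹ norm at most 1. -/
theorem sum_abs_policyProb_sub_le {θ' θ : PolicyParam S A} (hθ' : θ' ∈ subPolicies S A)
    (hθ : θ ∈ subPolicies S A) {δ : Fin n → ℝ}
    (hδ : ∀ i s, ∑ b, |θ' i (s, b) - θ i (s, b)| ≤ δ i) (s : S) :
    ∑ a, |policyProb θ' s a - policyProb θ s a| ≤ ∑ i, δ i := by
  have key : ∀ F : Finset (Fin n),
      ∑ a, |policyProb (F.piecewise θ' θ) s a - policyProb θ s a| ≤ ∑ i ∈ F, δ i := by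
    intro F
    induction F using Finset.induction_on with
    | empty => simp
    | insert k F hk ih =>
      have hsub : F.piecewise θ' θ ∈ subPolicies S A := by
        intro i s
        by_cases h : i ∈ F
        · simpa [h] using hθ' i s
        · simpa [h] using hθ i s
      -- Since `k ∉ F`, both hybrids are updates of the same parameter in slot `k`, so their
      -- difference is again a product.
      have hself : F.piecewise θ' θ = Function.update (F.piecewise θ' θ) k (θ k) := by
        rw [eq_comm, Function.update_eq_self_iff]
        simp [hk]
      rw [Finset.sum_insert hk, Finset.piecewise_insert]
      have h1 := sum_abs_policyProb_update_le hsub (k := k) (u := θ' k - θ k) (s := s) (hδ k s)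
      calc _ ≤ ∑ a, (|policyProb (Function.update (F.piecewise θ' θ) k (θ' k - θ k)) s a|
              + |policyProb (F.piecewise θ' θ) s a - policyProb θ s a|) := by
            refine Finset.sum_le_sum fun a _ => ?_
            rw [policyProb_update_sub, ← hself]
            exact abs_sub_le _ _ _
        _ ≤ _ := by rw [Finset.sum_add_distrib]; exact add_le_add h1 ih
  simpa using key Finset.univ

theorem jointPolicies_subset_subPolicies : jointPolicies S A ⊆ subPolicies S A := by
  intro θ hθ i s
  have h := hθ i s
  rw [Finset.sum_congr rfl fun b _ => abs_of_nonneg (h.1 b)]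
  exact h.2.le

theorem update_mem_jointPolicies {θ : PolicyParam S A} (hθ : θ ∈ jointPolicies S A) {k : Fin n}
    {x : EuclideanSpace ℝ (S × A k)} (hx : x ∈ agentPolicies S A k) :
    Function.update θ k x ∈ jointPolicies S A := by
  intro i
  by_cases h : i = k
  · subst h; simpa using hx
  · simpa [h] using hθ i

theorem convex_agentPolicies (k : Fin n) : Convex ℝ (agentPolicies S A k) :=
  fun _ hx _ hy _ _ ha hb hab s => convex_stdSimplex ℝ _ (hx s) (hy s) ha hb hab

theorem isCompact_agentPolicies (k : Fin n) : IsCompact (agentPolicies S A k) := by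
  have h : IsCompact {f : S × A k → ℝ | ∀ s, (fun a => f (s, a)) ∈ stdSimplex ℝ (A k)} := by
    refine (isCompact_Icc (a := (0 : S × A k → ℝ)) (b := 1)).of_isClosed_subset ?_ ?_
    · simp only [Set.ofPred_forall]
      refine isClosed_iInter fun s => (isClosed_stdSimplex ℝ (A k)).preimage ?_
      fun_prop
    · intro f hf
      refine ⟨fun p => (hf p.1).1 p.2, fun p => ?_⟩
      have h1 := Finset.single_le_sum (f := fun a => f (p.1, a)) (fun a _ => (hf p.1).1 a)
        (Finset.mem_univ p.2)
      rw [(hf p.1).2] at h1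
      exact h1
  have h2 := h.image (PiLp.continuous_toLp 2 fun _ : S × A k => ℝ)
  convert h2 using 1
  ext x
  constructor
  · intro hx
    exact ⟨x.ofLp, hx, rfl⟩
  · rintro ⟨f, hf, rfl⟩
    exact hf

theorem isCompact_jointPolicies : IsCompact (jointPolicies S A) := by
  have h := isCompact_univ_pi fun k => isCompact_agentPolicies (S := S) (A := A) k
  convert h using 1
  ext θ
  simp [jointPolicies]

theorem sum_abs_sub_le_two {k : Fin n} {x y : EuclideanSpace ℝ (S × A k)}
    (hx : x ∈ agentPolicies S A k) (hy : y ∈ agentPolicies S A k) (s : S) :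
    ∑ b, |(x - y) (s, b)| ≤ 2 := by
  calc _ ≤ ∑ b, (x (s, b) + y (s, b)) := by
        refine Finset.sum_le_sum fun b _ => ?_
        have h1 : 0 ≤ x (s, b) := (hx s).1 b
        have h2 : 0 ≤ y (s, b) := (hy s).1 b
        rw [PiLp.sub_apply, abs_le]
        constructor <;> linarith
    _ = 2 := by rw [Finset.sum_add_distrib, (hx s).2, (hy s).2]; norm_num

end PolicyProb

namespace MultiAgentMDP

variable {n : ℕ} {S : Type*} {A : Fin n → Type*} [Fintype S]

theorem abs_r_le_one (G : MultiAgentMDP n S A) (k : Fin n) (s : S) (a : ∀ i, A i) :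
    |G.r k s a| ≤ 1 := by
  rw [abs_of_nonneg (G.r_mem k s a).1]
  exact (G.r_mem k s a).2

theorem nonempty_state (G : MultiAgentMDP n S A) : Nonempty S := by
  by_contra h
  have : IsEmpty S := not_nonempty_iff.1 h
  have h1 := G.ρ_mem.2
  simp at h1

theorem abs_dotProduct_ρ_le (G : MultiAgentMDP n S A) (v : S → ℝ) : |G.ρ ⬝ᵥ v| ≤ ‖v‖ := by
  calc _ ≤ ∑ s, |G.ρ s * v s| := Finset.abs_sum_le_sum_abs _ _
    _ ≤ ∑ s, G.ρ s * ‖v‖ := by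
      refine Finset.sum_le_sum fun s _ => ?_
      rw [abs_mul, abs_of_nonneg (G.ρ_mem.1 s)]
      exact mul_le_mul_of_nonneg_left (norm_le_pi_norm v s) (G.ρ_mem.1 s)
    _ = ‖v‖ := by rw [← Finset.sum_mul, G.ρ_mem.2, one_mul]

theorem abs_sum_P_mul_le (G : MultiAgentMDP n S A) (s : S) (a : ∀ i, A i) (v : S → ℝ) :
    |∑ s', G.P s a s' * v s'| ≤ ‖v‖ := by
  calc _ ≤ ∑ s', |G.P s a s' * v s'| := Finset.abs_sum_le_sum_abs _ _
    _ ≤ ∑ s', G.P s a s' * ‖v‖ := by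
      refine Finset.sum_le_sum fun s' _ => ?_
      rw [abs_mul, abs_of_nonneg ((G.P_mem s a).1 s')]
      exact mul_le_mul_of_nonneg_left (norm_le_pi_norm v s') ((G.P_mem s a).1 s')
    _ = ‖v‖ := by rw [← Finset.sum_mul, (G.P_mem s a).2, one_mul]

end MultiAgentMDP

/-! ### Transition matrices and one-step lookahead for signed action weights. -/

namespace MultiAgentMDP

variable {n : ℕ} {S : Type*} {A : Fin n → Type*} [Fintype S]
  [∀ i, Fintype (A i)]

/-- The state transition matrix induced by the (possibly signed) action weights `m s a`. -/
def transMat (G : MultiAgentMDP n S A) (m : S → (∀ i, A i) → ℝ) : Matrix S S ℝ :=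
  Matrix.of fun s s' => ∑ a, m s a * G.P s a s'

/-- The one-step lookahead of `v`, averaged with the action weights `m s a`. -/
def bellman (G : MultiAgentMDP n S A) (f m : S → (∀ i, A i) → ℝ) (v : S → ℝ) : S → ℝ :=
  fun s => ∑ a, m s a * (f s a + G.γ * ∑ s', G.P s a s' * v s')

theorem norm_transMat_le (G : MultiAgentMDP n S A) {m : S → (∀ i, A i) → ℝ} {c : ℝ}
    (hc : 0 ≤ c) (hm : ∀ s, ∑ a, |m s a| ≤ c) [DecidableEq S] : ‖G.transMat m‖ ≤ c := by
  rw [Matrix.linfty_opNorm_def]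
  lift c to NNReal using hc
  rw [NNReal.coe_le_coe]
  refine Finset.sup_le fun s _ => ?_
  rw [← NNReal.coe_le_coe]
  push_cast
  refine le_trans ?_ (hm s)
  calc ∑ s', ‖G.transMat m s s'‖ ≤ ∑ s', ∑ a, |m s a| * G.P s a s' := by
        refine Finset.sum_le_sum fun s' _ => ?_
        refine (Finset.abs_sum_le_sum_abs _ _).trans (Finset.sum_le_sum fun a _ => ?_)
        rw [abs_mul, abs_of_nonneg ((G.P_mem s a).1 s')]
    _ = ∑ a, |m s a| := by
        rw [Finset.sum_comm]
        exact Finset.sum_congr rfl fun a _ => by rw [← Finset.mul_sum, (G.P_mem s a).2, mul_one]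

theorem norm_bellman_le (G : MultiAgentMDP n S A) {f m : S → (∀ i, A i) → ℝ} {v : S → ℝ} {c : ℝ}
    (hc : 0 ≤ c) (hm : ∀ s, ∑ a, |m s a| ≤ c) (hf : ∀ s a, |f s a| ≤ 1) :
    ‖G.bellman f m v‖ ≤ c * (1 + G.γ * ‖v‖) := by
  have hγ := G.γ_mem.1
  refine (pi_norm_le_iff_of_nonneg (by positivity)).2 fun s => ?_
  calc |G.bellman f m v s| ≤ ∑ a, |m s a| * (1 + G.γ * ‖v‖) := by
        refine (Finset.abs_sum_le_sum_abs _ _).trans (Finset.sum_le_sum fun a _ => ?_)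
        rw [abs_mul]
        gcongr
        refine (abs_add_le _ _).trans (add_le_add (hf s a) ?_)
        rw [abs_mul, abs_of_nonneg hγ]
        exact mul_le_mul_of_nonneg_left (G.abs_sum_P_mul_le s a v) hγ
    _ ≤ _ := by rw [← Finset.sum_mul]; exact mul_le_mul_of_nonneg_right (hm s) (by positivity)

theorem bellman_sub_left (G : MultiAgentMDP n S A) (f m m' : S → (∀ i, A i) → ℝ) (v : S → ℝ) :
    G.bellman f (m' - m) v = G.bellman f m' v - G.bellman f m v := by
  ext s
  simp [bellman, sub_mul]

theorem bellman_eq_add (G : MultiAgentMDP n S A) (f m : S → (∀ i, A i) → ℝ) (v : S → ℝ) :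
    G.bellman f m v = G.bellman f m 0 + (G.γ • G.transMat m).mulVec v := by
  ext s
  simp only [bellman, transMat, Matrix.mulVec, dotProduct, Pi.add_apply, Pi.zero_apply, mul_zero,
    Finset.sum_const_zero, add_zero, Matrix.smul_apply, Matrix.of_apply, smul_eq_mul, mul_add,
    Finset.sum_add_distrib, Finset.mul_sum, Finset.sum_mul]
  rw [Finset.sum_comm]
  congr 1
  exact Finset.sum_congr rfl fun _ _ => Finset.sum_congr rfl fun _ _ => by ring

theorem transMat_sub (G : MultiAgentMDP n S A) (m m' : S → (∀ i, A i) → ℝ) :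
    G.transMat (m' - m) = G.transMat m' - G.transMat m := by
  ext s s'
  simp [transMat, sub_mul]

theorem bellman_update_sub (G : MultiAgentMDP n S A) (f : S → (∀ i, A i) → ℝ)
    (θ : PolicyParam S A) (k : Fin n) (x y : EuclideanSpace ℝ (S × A k)) (v : S → ℝ) :
    G.bellman f (policyProb (Function.update θ k (x - y))) v
      = G.bellman f (policyProb (Function.update θ k x)) v
        - G.bellman f (policyProb (Function.update θ k y)) v := by
  rw [← bellman_sub_left]
  congr 1
  ext s a
  exact policyProb_update_sub θ k x y s a

theorem bellman_update_add (G : MultiAgentMDP n S A) (f : S → (∀ i, A i) → ℝ)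
    (θ : PolicyParam S A) (k : Fin n) (x y : EuclideanSpace ℝ (S × A k)) (v : S → ℝ) :
    G.bellman f (policyProb (Function.update θ k (x + y))) v
      = G.bellman f (policyProb (Function.update θ k x)) v
        + G.bellman f (policyProb (Function.update θ k y)) v := by
  ext s
  simp [bellman, policyProb_update_add, add_mul, Finset.sum_add_distrib]

theorem bellman_update_smul (G : MultiAgentMDP n S A) (f : S → (∀ i, A i) → ℝ)
    (θ : PolicyParam S A) (k : Fin n) (c : ℝ) (x : EuclideanSpace ℝ (S × A k)) (v : S → ℝ) :
    G.bellman f (policyProb (Function.update θ k (c • x))) v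
      = c • G.bellman f (policyProb (Function.update θ k x)) v := by
  ext s
  simp [bellman, policyProb_update_smul, mul_assoc, Finset.mul_sum]

/-- The one-step lookahead at state `s` as a linear function of the component of agent `k`. -/
noncomputable def bellmanCLM (G : MultiAgentMDP n S A) (f : S → (∀ i, A i) → ℝ) (k : Fin n)
    (θ : PolicyParam S A) (v : S → ℝ) (s : S) : EuclideanSpace ℝ (S × A k) →L[ℝ] ℝ :=
  LinearMap.toContinuousLinearMap
    { toFun := fun u => G.bellman f (policyProb (Function.update θ k u)) v s
      map_add' := fun x y => by rw [bellman_update_add]; rfl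
      map_smul' := fun c x => by rw [bellman_update_smul]; rfl }

theorem bellmanCLM_apply (G : MultiAgentMDP n S A) (f : S → (∀ i, A i) → ℝ) (k : Fin n)
    (θ : PolicyParam S A) (v : S → ℝ) (s : S) (u : EuclideanSpace ℝ (S × A k)) :
    G.bellmanCLM f k θ v s u = G.bellman f (policyProb (Function.update θ k u)) v s := rfl

theorem continuous_smul_transMat (G : MultiAgentMDP n S A) :
    Continuous fun θ : PolicyParam S A => G.γ • G.transMat (policyProb θ) := by
  refine Continuous.const_smul (M := ℝ) ?_ G.γ
  refine continuous_matrix fun s s' => ?_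
  simp only [transMat, policyProb, Matrix.of_apply]
  fun_prop

/-- Only the row at `s` matters; this later allows maximizers chosen separately at each state to be
glued into one policy. -/
theorem bellmanCLM_congr (G : MultiAgentMDP n S A) (f : S → (∀ i, A i) → ℝ) (k : Fin n)
    (θ : PolicyParam S A) (v : S → ℝ) (s : S) {x y : EuclideanSpace ℝ (S × A k)}
    (h : ∀ b, x (s, b) = y (s, b)) : G.bellmanCLM f k θ v s x = G.bellmanCLM f k θ v s y := by
  simp only [bellmanCLM_apply, bellman, policyProb_update, h]

/-- The squared Euclidean distance between joint policies. -/
noncomputable def sqDist (θ' θ : PolicyParam S A) : ℝ := ∑ i, ‖θ' i - θ i‖ ^ 2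

theorem sq_sum_sqrt_card_mul_norm_le (θ' θ : PolicyParam S A) :
    (∑ i, √(Fintype.card (A i)) * ‖θ' i - θ i‖) ^ 2
      ≤ (∑ i, (Fintype.card (A i) : ℝ)) * sqDist θ' θ := by
  refine (Finset.sum_mul_sq_le_sq_mul_sq _ _ _).trans (le_of_eq ?_)
  simp only [Real.sq_sqrt (Nat.cast_nonneg _), sqDist]

/-! ### Resolvent, Bellman equation and performance differences. -/

variable [DecidableEq S]

/-- The discounted occupation matrix `∑ₜ γ^t K_θ^t`. -/
noncomputable def resolvent (G : MultiAgentMDP n S A) (θ : PolicyParam S A) : Matrix S S ℝ :=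
  ∑' t : ℕ, (G.γ • G.transMat (policyProb θ)) ^ t

/-- Parameters at which the discounted transition matrix is a strict contraction. -/
def contracting (G : MultiAgentMDP n S A) : Set (PolicyParam S A) :=
  {θ | ‖G.γ • G.transMat (policyProb θ)‖ < 1}

theorem norm_transMat_le_one (G : MultiAgentMDP n S A) {θ : PolicyParam S A}
    (hθ : θ ∈ subPolicies S A) : ‖G.γ • G.transMat (policyProb θ)‖ ≤ G.γ := by
  rw [norm_smul, Real.norm_of_nonneg G.γ_mem.1]
  have := G.norm_transMat_le zero_le_one (sum_abs_policyProb_le hθ)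
  nlinarith [G.γ_mem.1]

theorem subPolicies_subset_contracting (G : MultiAgentMDP n S A) :
    subPolicies S A ⊆ G.contracting :=
  fun _ hθ => (G.norm_transMat_le_one hθ).trans_lt G.γ_mem.2

theorem jointPolicies_subset_contracting (G : MultiAgentMDP n S A) :
    jointPolicies S A ⊆ G.contracting :=
  jointPolicies_subset_subPolicies.trans G.subPolicies_subset_contracting

theorem stateProb_eq_pow (G : MultiAgentMDP n S A) (θ : PolicyParam S A) (t : ℕ) (s₀ s : S) :
    G.stateProb θ t s₀ s = (G.transMat (policyProb θ) ^ t) s₀ s := by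
  induction t generalizing s with
  | zero => simp [stateProb, Matrix.one_apply, eq_comm]
  | succ t ih =>
    rw [pow_succ, Matrix.mul_apply, stateProb]
    exact Finset.sum_congr rfl fun s' _ => by rw [ih]; rfl

theorem hasSum_resolvent (G : MultiAgentMDP n S A) {θ : PolicyParam S A} (hθ : θ ∈ G.contracting)
    (s₀ s : S) : HasSum (fun t : ℕ => G.γ ^ t * G.stateProb θ t s₀ s) (G.resolvent θ s₀ s) := by
  have h : HasSum (fun t : ℕ => (G.γ • G.transMat (policyProb θ)) ^ t) (G.resolvent θ) :=
    (summable_geometric_of_norm_lt_one hθ).hasSum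
  have h2 := Pi.hasSum.1 (Pi.hasSum.1 h s₀) s
  convert h2 using 2 with t
  rw [stateProb_eq_pow, smul_pow]
  rfl

theorem mul_resolvent (G : MultiAgentMDP n S A) {θ : PolicyParam S A} (hθ : θ ∈ G.contracting) :
    (1 - G.γ • G.transMat (policyProb θ)) * G.resolvent θ = 1 :=
  mul_neg_geom_series _ hθ

theorem resolvent_mul (G : MultiAgentMDP n S A) {θ : PolicyParam S A} (hθ : θ ∈ G.contracting) :
    G.resolvent θ * (1 - G.γ • G.transMat (policyProb θ)) = 1 :=
  geom_series_mul_neg _ hθ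

theorem value_eq_mulVec (G : MultiAgentMDP n S A) (f : S → (∀ i, A i) → ℝ) {θ : PolicyParam S A}
    (hθ : θ ∈ G.contracting) :
    G.value f θ = (G.resolvent θ).mulVec (G.bellman f (policyProb θ) 0) := by
  ext s₀
  have h := hasSum_sum fun s (_ : s ∈ Finset.univ) =>
    (G.hasSum_resolvent hθ s₀ s).mul_right (G.bellman f (policyProb θ) 0 s)
  refine Eq.trans ?_ h.tsum_eq
  unfold value
  refine tsum_congr fun t => ?_
  rw [Finset.mul_sum]
  exact Finset.sum_congr rfl fun s _ => by simp [bellman, mul_assoc]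

theorem visitation_eq (G : MultiAgentMDP n S A) {θ : PolicyParam S A}
    (hθ : θ ∈ G.contracting) (s : S) :
    G.visitation θ s = (1 - G.γ) * ∑ s₀, G.ρ s₀ * G.resolvent θ s₀ s := by
  unfold visitation
  rw [Finset.mul_sum]
  refine Finset.sum_congr rfl fun s₀ _ => ?_
  rw [(G.hasSum_resolvent hθ s₀ s).tsum_eq]; ring

theorem value_eq_bellman (G : MultiAgentMDP n S A) (f : S → (∀ i, A i) → ℝ) {θ : PolicyParam S A}
    (hθ : θ ∈ G.contracting) :
    G.value f θ = G.bellman f (policyProb θ) (G.value f θ) := by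
  rw [bellman_eq_add]
  have h : (1 - G.γ • G.transMat (policyProb θ)).mulVec (G.value f θ)
      = G.bellman f (policyProb θ) 0 := by
    rw [value_eq_mulVec G f hθ, Matrix.mulVec_mulVec, G.mul_resolvent hθ,
      Matrix.one_mulVec]
  rw [← h, Matrix.sub_mulVec, Matrix.one_mulVec, sub_add_cancel]

/-- The performance difference identity. -/
theorem value_sub_value (G : MultiAgentMDP n S A) (f : S → (∀ i, A i) → ℝ)
    {θ' θ : PolicyParam S A} (hθ' : θ' ∈ G.contracting) (hθ : θ ∈ G.contracting) :
    G.value f θ' - G.value f θ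
      = (G.resolvent θ').mulVec
          (G.bellman f (policyProb θ' - policyProb θ) (G.value f θ)) := by
  -- Subtract the Bellman equations of `θ'` and `θ`; the lookahead is affine in the value vector
  -- with linear part `γ K_θ'`.
  have h1 : G.bellman f (policyProb θ' - policyProb θ) (G.value f θ)
      = (1 - G.γ • G.transMat (policyProb θ')).mulVec (G.value f θ' - G.value f θ) := by
    have h2 := G.value_eq_bellman f hθ'
    rw [bellman_eq_add] at h2
    rw [bellman_sub_left, ← value_eq_bellman G f hθ, bellman_eq_add, Matrix.mulVec_sub,
      Matrix.sub_mulVec, Matrix.sub_mulVec, Matrix.one_mulVec, Matrix.one_mulVec]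
    rw [eq_sub_of_add_eq h2.symm]
    abel
  rw [h1, Matrix.mulVec_mulVec, G.resolvent_mul hθ',
    Matrix.one_mulVec]

theorem resolvent_sub_resolvent (G : MultiAgentMDP n S A)
    {θ' θ : PolicyParam S A} (hθ' : θ' ∈ G.contracting) (hθ : θ ∈ G.contracting) :
    G.resolvent θ' - G.resolvent θ
      = G.resolvent θ' * (G.γ • G.transMat (policyProb θ' - policyProb θ)) * G.resolvent θ := by
  rw [transMat_sub, smul_sub]
  calc _ = G.resolvent θ' * ((1 - G.γ • G.transMat (policyProb θ)) * G.resolvent θ)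
        - G.resolvent θ' * (1 - G.γ • G.transMat (policyProb θ')) * G.resolvent θ := by
          rw [G.resolvent_mul hθ', G.mul_resolvent hθ, mul_one, one_mul]
    _ = _ := by noncomm_ring

theorem resolvent_nonneg (G : MultiAgentMDP n S A) {θ : PolicyParam S A}
    (hθ : θ ∈ jointPolicies S A) (s₀ s : S) : 0 ≤ G.resolvent θ s₀ s := by
  rw [← (G.hasSum_resolvent (G.jointPolicies_subset_contracting hθ) s₀ s).tsum_eq]
  refine tsum_nonneg fun t => mul_nonneg (pow_nonneg G.γ_mem.1 t) ?_
  induction t generalizing s with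
  | zero => unfold stateProb; split_ifs <;> simp
  | succ t ih =>
    exact Finset.sum_nonneg fun s' _ => mul_nonneg (ih s') <| Finset.sum_nonneg fun a _ =>
      mul_nonneg (Finset.prod_nonneg fun i _ => (hθ i s').1 (a i)) ((G.P_mem s' a).1 s)

theorem norm_resolvent_le (G : MultiAgentMDP n S A) [Nonempty S] {θ : PolicyParam S A}
    (hθ : θ ∈ subPolicies S A) : ‖G.resolvent θ‖ ≤ (1 - G.γ)⁻¹ := by
  have : NormOneClass (Matrix S S ℝ) := Matrix.linfty_opNormOneClass
  have h := tsum_geometric_le_of_norm_lt_one _ (G.subPolicies_subset_contracting hθ)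
  rw [norm_one, sub_self, zero_add] at h
  refine h.trans (inv_anti₀ (sub_pos.2 G.γ_mem.2) ?_)
  linarith [G.norm_transMat_le_one hθ]

/-! ### First variation and its Lipschitz bounds. -/

/-- The first variation of the total return of `f` in the component of agent `k`: occupation
measure taken at `θ''`, action values taken at `θ'`, evaluated on the direction `u`. -/
noncomputable def gradForm (G : MultiAgentMDP n S A) (f : S → (∀ i, A i) → ℝ) (k : Fin n)
    (θ'' θ' : PolicyParam S A) (u : EuclideanSpace ℝ (S × A k)) : ℝ :=
  G.ρ ⬝ᵥ (G.resolvent θ'').mulVec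
    (G.bellman f (policyProb (Function.update θ' k u)) (G.value f θ'))

theorem totalPotential_eq (G : MultiAgentMDP n S A) (f : S → (∀ i, A i) → ℝ)
    (θ : PolicyParam S A) : G.totalPotential f θ = G.ρ ⬝ᵥ G.value f θ := rfl

theorem gradForm_smul (G : MultiAgentMDP n S A) (f : S → (∀ i, A i) → ℝ) (k : Fin n)
    (θ'' θ' : PolicyParam S A) (c : ℝ) (u : EuclideanSpace ℝ (S × A k)) :
    G.gradForm f k θ'' θ' (c • u) = c * G.gradForm f k θ'' θ' u := by
  unfold gradForm
  rw [bellman_update_smul, Matrix.mulVec_smul, dotProduct_smul, smul_eq_mul]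

theorem totalPotential_update_sub (G : MultiAgentMDP n S A) (f : S → (∀ i, A i) → ℝ)
    {θ : PolicyParam S A} {k : Fin n} {x : EuclideanSpace ℝ (S × A k)}
    (hθ : θ ∈ G.contracting) (hx : Function.update θ k x ∈ G.contracting) :
    G.totalPotential f (Function.update θ k x) - G.totalPotential f θ
      = G.gradForm f k (Function.update θ k x) θ (x - θ k) := by
  rw [totalPotential_eq, totalPotential_eq, ← dotProduct_sub, G.value_sub_value f hx hθ, gradForm,
    bellman_update_sub, Function.update_eq_self, bellman_sub_left]

/-- The Bellman equation gives `‖V‖ ≤ 1 + γ ‖V‖`. -/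
theorem norm_value_le (G : MultiAgentMDP n S A) {f : S → (∀ i, A i) → ℝ}
    (hf : ∀ s a, |f s a| ≤ 1) {θ : PolicyParam S A} (hθ : θ ∈ subPolicies S A) :
    ‖G.value f θ‖ ≤ (1 - G.γ)⁻¹ := by
  have h := G.norm_bellman_le (v := G.value f θ) zero_le_one (sum_abs_policyProb_le hθ) hf
  rw [← G.value_eq_bellman f (G.subPolicies_subset_contracting hθ)] at h
  have hγ : 0 < 1 - G.γ := sub_pos.2 G.γ_mem.2
  rw [← one_div, le_div_iff₀ hγ]
  linarith

theorem norm_value_sub_le (G : MultiAgentMDP n S A) {f : S → (∀ i, A i) → ℝ}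
    (hf : ∀ s a, |f s a| ≤ 1) {θ' θ : PolicyParam S A} (hθ' : θ' ∈ subPolicies S A)
    (hθ : θ ∈ subPolicies S A) {D : ℝ} (hD : 0 ≤ D)
    (h : ∀ s, ∑ a, |policyProb θ' s a - policyProb θ s a| ≤ D) :
    ‖G.value f θ' - G.value f θ‖ ≤ D / (1 - G.γ) ^ 2 := by
  have := G.nonempty_state
  have hγ : 0 < 1 - G.γ := sub_pos.2 G.γ_mem.2
  have hγ0 := G.γ_mem.1
  rw [G.value_sub_value f (G.subPolicies_subset_contracting hθ')
    (G.subPolicies_subset_contracting hθ)]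
  calc _ ≤ (1 - G.γ)⁻¹ * (D * (1 + G.γ * (1 - G.γ)⁻¹)) := by
        refine (Matrix.linfty_opNorm_mulVec _ _).trans ?_
        gcongr
        · exact G.norm_resolvent_le hθ'
        · refine (G.norm_bellman_le hD h hf).trans ?_
          gcongr
          exact G.norm_value_le hf hθ
    _ = _ := by field_simp; ring

/-- Change the occupation measure and the action values separately. The resolvent identity
contributes the extra `γ` on `δ''`. On the action-value side, the policy change and the value change
add up as `D / (1 - γ) + γ D / (1 - γ)² = D / (1 - γ)²`. -/
theorem abs_gradForm_sub_le_of_le_one (G : MultiAgentMDP n S A) {f : S → (∀ i, A i) → ℝ}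
    (hf : ∀ s a, |f s a| ≤ 1) {θ'' θ' θ : PolicyParam S A} (hθ'' : θ'' ∈ subPolicies S A)
    (hθ' : θ' ∈ subPolicies S A) (hθ : θ ∈ subPolicies S A) {δ'' δ' : Fin n → ℝ}
    (hδ'' : ∀ i s, ∑ b, |θ'' i (s, b) - θ i (s, b)| ≤ δ'' i)
    (hδ' : ∀ i s, ∑ b, |θ' i (s, b) - θ i (s, b)| ≤ δ' i)
    {k : Fin n} {u : EuclideanSpace ℝ (S × A k)} (hu : ∀ s, ∑ b, |u (s, b)| ≤ 1) :
    |G.gradForm f k θ'' θ' u - G.gradForm f k θ θ u|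
      ≤ (G.γ * ∑ i, δ'' i + ∑ i, δ' i) / (1 - G.γ) ^ 3 := by
  have := G.nonempty_state
  have hγ : 0 < 1 - G.γ := sub_pos.2 G.γ_mem.2
  have hγ0 := G.γ_mem.1
  obtain ⟨s₀⟩ := id this
  have hD'' : 0 ≤ ∑ i, δ'' i := (Finset.sum_nonneg fun _ _ => abs_nonneg _).trans
    (sum_abs_policyProb_sub_le hθ'' hθ hδ'' s₀)
  have hD' : 0 ≤ ∑ i, δ' i := (Finset.sum_nonneg fun _ _ => abs_nonneg _).trans
    (sum_abs_policyProb_sub_le hθ' hθ hδ' s₀)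
  -- The same direction `u` fills slot `k` on both sides, so this slot contributes nothing.
  have hδu : ∀ i s, ∑ b, |(Function.update θ' k u) i (s, b) - (Function.update θ k u) i (s, b)|
      ≤ δ' i := by
    intro i s
    by_cases h : i = k
    · subst h
      simpa using (Finset.sum_nonneg fun _ _ => abs_nonneg _).trans (hδ' i s)
    · simpa [h] using hδ' i s
  set q' := G.bellman f (policyProb (Function.update θ' k u)) (G.value f θ') with hq'
  set q := G.bellman f (policyProb (Function.update θ k u)) (G.value f θ) with hq
  have hq1 : ‖q'‖ ≤ (1 - G.γ)⁻¹ := by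
    refine (G.norm_bellman_le zero_le_one
      (sum_abs_policyProb_le (update_mem_subPolicies hθ' hu)) hf).trans ?_
    calc _ ≤ 1 * (1 + G.γ * (1 - G.γ)⁻¹) := by gcongr; exact G.norm_value_le hf hθ'
      _ = _ := by field_simp; ring
  have hq2 : ‖q' - q‖ ≤ (∑ i, δ' i) / (1 - G.γ) ^ 2 := by
    have e : q' - q = G.bellman f (policyProb (Function.update θ' k u)
          - policyProb (Function.update θ k u)) (G.value f θ')
        + (G.γ • G.transMat (policyProb (Function.update θ k u))).mulVec
            (G.value f θ' - G.value f θ) := by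
      rw [bellman_sub_left, Matrix.mulVec_sub, hq', hq,
        G.bellman_eq_add f (policyProb (Function.update θ k u)) (G.value f θ'),
        G.bellman_eq_add f (policyProb (Function.update θ k u)) (G.value f θ)]
      abel
    rw [e]
    calc _ ≤ (∑ i, δ' i) * (1 + G.γ * (1 - G.γ)⁻¹)
          + G.γ * ((∑ i, δ' i) / (1 - G.γ) ^ 2) := by
          refine (norm_add_le _ _).trans (add_le_add ?_ ?_)
          · refine (G.norm_bellman_le hD' (sum_abs_policyProb_sub_le
              (update_mem_subPolicies hθ' hu) (update_mem_subPolicies hθ hu) hδu) hf).trans ?_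
            gcongr
            exact G.norm_value_le hf hθ'
          · refine (Matrix.linfty_opNorm_mulVec _ _).trans ?_
            gcongr
            · exact G.norm_transMat_le_one (update_mem_subPolicies hθ hu)
            · exact G.norm_value_sub_le hf hθ' hθ hD' (sum_abs_policyProb_sub_le hθ' hθ hδ')
      _ = _ := by field_simp; ring
  have hN : ‖G.resolvent θ'' - G.resolvent θ‖ ≤ G.γ * (∑ i, δ'' i) / (1 - G.γ) ^ 2 := by
    rw [G.resolvent_sub_resolvent (G.subPolicies_subset_contracting hθ'')
      (G.subPolicies_subset_contracting hθ)]
    calc _ ≤ (1 - G.γ)⁻¹ * (G.γ * ∑ i, δ'' i) * (1 - G.γ)⁻¹ := by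
          refine (norm_mul_le _ _).trans ?_
          gcongr
          · refine (norm_mul_le _ _).trans ?_
            gcongr
            · exact G.norm_resolvent_le hθ''
            · rw [norm_smul, Real.norm_of_nonneg hγ0]
              gcongr
              exact G.norm_transMat_le hD'' (sum_abs_policyProb_sub_le hθ'' hθ hδ'')
          · exact G.norm_resolvent_le hθ
      _ = _ := by field_simp
  have e : G.gradForm f k θ'' θ' u - G.gradForm f k θ θ u
      = G.ρ ⬝ᵥ ((G.resolvent θ'' - G.resolvent θ).mulVec q' + (G.resolvent θ).mulVec (q' - q)) := by
    rw [gradForm, gradForm, ← dotProduct_sub, Matrix.sub_mulVec, Matrix.mulVec_sub]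
    congr 1
    abel
  rw [e]
  calc _ ≤ G.γ * (∑ i, δ'' i) / (1 - G.γ) ^ 2 * (1 - G.γ)⁻¹
        + (1 - G.γ)⁻¹ * ((∑ i, δ' i) / (1 - G.γ) ^ 2) := by
        refine (G.abs_dotProduct_ρ_le _).trans ((norm_add_le _ _).trans (add_le_add ?_ ?_))
        · refine (Matrix.linfty_opNorm_mulVec _ _).trans ?_
          gcongr
        · refine (Matrix.linfty_opNorm_mulVec _ _).trans ?_
          gcongr
          exact G.norm_resolvent_le hθ
    _ = _ := by field_simp

theorem abs_gradForm_sub_le (G : MultiAgentMDP n S A) {f : S → (∀ i, A i) → ℝ}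
    (hf : ∀ s a, |f s a| ≤ 1) {θ'' θ' θ : PolicyParam S A} (hθ'' : θ'' ∈ subPolicies S A)
    (hθ' : θ' ∈ subPolicies S A) (hθ : θ ∈ subPolicies S A) {δ'' δ' : Fin n → ℝ}
    (hδ'' : ∀ i s, ∑ b, |θ'' i (s, b) - θ i (s, b)| ≤ δ'' i)
    (hδ' : ∀ i s, ∑ b, |θ' i (s, b) - θ i (s, b)| ≤ δ' i)
    {k : Fin n} {u : EuclideanSpace ℝ (S × A k)} {c : ℝ} (hc : 0 ≤ c)
    (hu : ∀ s, ∑ b, |u (s, b)| ≤ c) :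
    |G.gradForm f k θ'' θ' u - G.gradForm f k θ θ u|
      ≤ c * (G.γ * ∑ i, δ'' i + ∑ i, δ' i) / (1 - G.γ) ^ 3 := by
  rcases hc.eq_or_lt with rfl | hc
  · have h0 : u = 0 := by
      ext ⟨s, b⟩
      have h := (Finset.sum_eq_zero_iff_of_nonneg fun _ _ => abs_nonneg _).1
        (le_antisymm (hu s) (Finset.sum_nonneg fun _ _ => abs_nonneg _)) b (Finset.mem_univ b)
      simpa using h
    rw [h0, ← zero_smul ℝ (0 : EuclideanSpace ℝ (S × A k))]
    simp only [gradForm_smul]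
    simp
  · have hu' : ∀ s, ∑ b, |(c⁻¹ • u) (s, b)| ≤ 1 := by
      intro s
      simp only [PiLp.smul_apply, smul_eq_mul, abs_mul, ← Finset.mul_sum,
        abs_of_pos (inv_pos.2 hc)]
      rw [inv_mul_le_iff₀ hc, mul_one]
      exact hu s
    have h := G.abs_gradForm_sub_le_of_le_one hf hθ'' hθ' hθ hδ'' hδ' hu'
    rw [gradForm_smul, gradForm_smul, ← mul_sub, abs_mul, abs_of_pos (inv_pos.2 hc),
      inv_mul_le_iff₀ hc] at h
    rwa [mul_div_assoc]

/-! ### Continuity of the resolvent and the policy gradient. -/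

theorem isOpen_contracting (G : MultiAgentMDP n S A) : IsOpen G.contracting :=
  isOpen_lt G.continuous_smul_transMat.norm continuous_const

/-- Inversion in a Banach algebra is continuous at units, and the Neumann series is the inverse
throughout an open set of parameters. -/
theorem continuousAt_resolvent (G : MultiAgentMDP n S A) {θ : PolicyParam S A}
    (hθ : θ ∈ G.contracting) : ContinuousAt G.resolvent θ := by
  have h1 : ContinuousAt (fun θ => Ring.inverse (1 - G.γ • G.transMat (policyProb θ))) θ := by
    refine ContinuousAt.comp (g := Ring.inverse) ?_
      (continuous_const.sub G.continuous_smul_transMat).continuousAt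
    exact NormedRing.inverse_continuousAt (Units.oneSub _ hθ)
  refine h1.congr ?_
  filter_upwards [G.isOpen_contracting.mem_nhds hθ] with θ' hθ'
  exact NormedRing.inverse_one_sub _ hθ'

theorem continuousAt_resolvent_apply (G : MultiAgentMDP n S A) {θ : PolicyParam S A}
    (hθ : θ ∈ G.contracting) (s₀ s : S) : ContinuousAt (fun θ => G.resolvent θ s₀ s) θ :=
  continuousAt_pi.1 (continuousAt_pi.1 (G.continuousAt_resolvent hθ) s₀) s

/-- The unnormalised discounted occupation measure. -/
noncomputable def occupation (G : MultiAgentMDP n S A) (θ : PolicyParam S A) (s : S) : ℝ :=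
  ∑ s₀, G.ρ s₀ * G.resolvent θ s₀ s

theorem gradForm_eq_sum (G : MultiAgentMDP n S A) (f : S → (∀ i, A i) → ℝ) (k : Fin n)
    (θ'' θ' : PolicyParam S A) (u : EuclideanSpace ℝ (S × A k)) :
    G.gradForm f k θ'' θ' u
      = ∑ s, G.occupation θ'' s * G.bellmanCLM f k θ' (G.value f θ') s u := by
  rw [gradForm, Matrix.dotProduct_mulVec]
  rfl

theorem continuousAt_occupation (G : MultiAgentMDP n S A) {θ : PolicyParam S A}
    (hθ : θ ∈ G.contracting) (s : S) : ContinuousAt (fun θ => G.occupation θ s) θ :=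
  tendsto_finsetSum _ fun s₀ _ => (G.continuousAt_resolvent_apply hθ s₀ s).const_mul _

end MultiAgentMDP

/-- Continuity of `w` suffices because the other factor vanishes at `a`. The performance difference
identity can thus be differentiated without differentiating the resolvent. -/
theorem ContinuousAt.hasFDerivAt_mul_clm_sub {E : Type*} [NormedAddCommGroup E] [NormedSpace ℝ E]
    {w : E → ℝ} {a : E} (hw : ContinuousAt w a) (Q : E →L[ℝ] ℝ) :
    HasFDerivAt (fun x => w x * Q (x - a)) (w a • Q) a := by
  refine HasFDerivAt.of_isLittleO ?_
  have h1 : (fun x => w x - w a) =o[nhds a] fun _ => (1 : ℝ) :=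
    (Asymptotics.isLittleO_one_iff ℝ).2 (tendsto_sub_nhds_zero_iff.2 hw)
  have h2 : (fun x => Q (x - a)) =O[nhds a] fun x => x - a := Q.isBigO_comp _ _
  have h3 := h1.mul_isBigO h2.norm_right
  simp only [one_mul] at h3
  refine h3.of_norm_right.congr_left fun x => ?_
  simp
  ring

namespace MultiAgentMDP

variable {n : ℕ} {S : Type*} {A : Fin n → Type*} [Fintype S]
  [∀ i, Fintype (A i)] [DecidableEq S]

/-- Near `θ k` the return equals a constant plus continuous occupation weights times linear forms in
`x - θ k`, so only the weights at `θ` survive in the derivative. -/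
theorem inner_gradient_totalPotential (G : MultiAgentMDP n S A) (f : S → (∀ i, A i) → ℝ)
    {θ : PolicyParam S A} (hθ : θ ∈ G.contracting) (k : Fin n)
    (u : EuclideanSpace ℝ (S × A k)) :
    inner ℝ (gradient (fun x => G.totalPotential f (Function.update θ k x)) (θ k)) u
      = G.gradForm f k θ θ u := by
  have hc : ContinuousAt (fun x => Function.update θ k x) (θ k) :=
    (continuous_const.update k continuous_id).continuousAt
  have hs : Function.update θ k (θ k) = θ := Function.update_eq_self k θ
  have h1 : HasFDerivAt (fun x => G.totalPotential f θ
      + ∑ s, G.occupation (Function.update θ k x) s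
          * G.bellmanCLM f k θ (G.value f θ) s (x - θ k))
      (∑ s, G.occupation (Function.update θ k (θ k)) s • G.bellmanCLM f k θ (G.value f θ) s)
      (θ k) := by
    refine HasFDerivAt.const_add _ (HasFDerivAt.fun_sum fun s _ => ?_)
    refine ContinuousAt.hasFDerivAt_mul_clm_sub
      (w := fun x => G.occupation (Function.update θ k x) s) ?_ _
    refine ContinuousAt.comp (g := fun θ => G.occupation θ s) ?_ hc
    rw [hs]
    exact G.continuousAt_occupation hθ s
  have he : (fun x => G.totalPotential f (Function.update θ k x)) =ᶠ[nhds (θ k)]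
      fun x => G.totalPotential f θ + ∑ s, G.occupation (Function.update θ k x) s
          * G.bellmanCLM f k θ (G.value f θ) s (x - θ k) := by
    have hmem : ∀ᶠ x in nhds (θ k), Function.update θ k x ∈ G.contracting :=
      hc.eventually (by beta_reduce; rw [hs]; exact G.isOpen_contracting.mem_nhds hθ)
    filter_upwards [hmem] with x hx
    rw [← gradForm_eq_sum, ← G.totalPotential_update_sub f hθ hx]
    ring
  rw [gradient, InnerProductSpace.toDual_symm_apply, (h1.congr_of_eventuallyEq he).fderiv, hs, gradForm_eq_sum]
  simp

theorem inner_policyGradient (G : MultiAgentMDP n S A)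
    {θ : PolicyParam S A} (hθ : θ ∈ G.contracting) (k : Fin n)
    (u : EuclideanSpace ℝ (S × A k)) :
    inner ℝ (G.policyGradient θ k) u = G.gradForm (G.r k) k θ θ u :=
  G.inner_gradient_totalPotential (G.r k) hθ k u

end MultiAgentMDP

/-! ### Euclidean projection and norm comparisons. -/

theorem inner_sub_euclideanProj_nonpos {E : Type*} [NormedAddCommGroup E] [InnerProductSpace ℝ E]
    {K : Set E} (hne : K.Nonempty) (hcomp : IsComplete K) (hconv : Convex ℝ K) (u : E) {w : E}
    (hw : w ∈ K) : inner ℝ (u - euclideanProj K u) (w - euclideanProj K u) ≤ 0 := by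
  obtain ⟨hmem, hmin⟩ := euclideanProj_spec hne hcomp hconv u
  refine (norm_eq_iInf_iff_real_inner_le_zero hconv hmem).1 ?_ w hw
  have : Nonempty K := hne.to_subtype
  refine le_antisymm (le_ciInf fun v => hmin v v.2) ?_
  exact ciInf_le (f := fun v : K => ‖u - v‖) ⟨0, by rintro _ ⟨x, rfl⟩; exact norm_nonneg _⟩
    ⟨_, hmem⟩

section Policies

variable {n : ℕ} {S : Type*} {A : Fin n → Type*} [Fintype S] [∀ i, Fintype (A i)]

theorem sum_abs_le_sqrt_card_mul_norm {k : Fin n} (u : EuclideanSpace ℝ (S × A k)) (s : S) :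
    ∑ b, |u (s, b)| ≤ √(Fintype.card (A k)) * ‖u‖ := by
  rw [EuclideanSpace.norm_eq, ← Real.sqrt_mul (Nat.cast_nonneg _)]
  refine Real.le_sqrt_of_sq_le ?_
  have h1 : (∑ b, |u (s, b)|) ^ 2 ≤ Fintype.card (A k) * ∑ b, |u (s, b)| ^ 2 :=
    sq_sum_le_card_mul_sum_sq
  refine h1.trans (mul_le_mul_of_nonneg_left ?_ (Nat.cast_nonneg _))
  rw [Fintype.sum_prod_type]
  exact Finset.single_le_sum (f := fun s => ∑ b, ‖u (s, b)‖ ^ 2)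
    (fun s _ => Finset.sum_nonneg fun _ _ => by positivity) (Finset.mem_univ s)

theorem norm_sub_le_of_mem_agentPolicies {k : Fin n} {x y : EuclideanSpace ℝ (S × A k)}
    (hx : x ∈ agentPolicies S A k) (hy : y ∈ agentPolicies S A k) :
    ‖x - y‖ ≤ 2 * √(Fintype.card S) := by
  rw [EuclideanSpace.norm_eq, ← Real.sqrt_sq (zero_le_two (α := ℝ)),
    ← Real.sqrt_mul (by positivity)]
  refine Real.sqrt_le_sqrt ?_
  rw [Fintype.sum_prod_type]
  calc _ ≤ ∑ _s : S, (2 : ℝ) ^ 2 := by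
        refine Finset.sum_le_sum fun s _ => ?_
        refine (Finset.sum_sq_le_sq_sum_of_nonneg fun b _ => norm_nonneg _).trans ?_
        gcongr
        exact sum_abs_sub_le_two hx hy s
    _ = _ := by simp [mul_comm]

end Policies

/-! ### Distribution mismatch, potential increments and gradient domination. -/

namespace MultiAgentMDP

variable {n : ℕ} {S : Type*} {A : Fin n → Type*} [Fintype S]
  [∀ i, Fintype (A i)] [DecidableEq S]

theorem visitation_eq_occupation (G : MultiAgentMDP n S A) {θ : PolicyParam S A}
    (hθ : θ ∈ G.contracting) (s : S) :
    G.visitation θ s = (1 - G.γ) * G.occupation θ s :=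
  G.visitation_eq hθ s

theorem occupation_nonneg (G : MultiAgentMDP n S A) {θ : PolicyParam S A}
    (hθ : θ ∈ jointPolicies S A) (s : S) : 0 ≤ G.occupation θ s :=
  Finset.sum_nonneg fun s₀ _ => mul_nonneg (G.ρ_mem.1 s₀) (G.resolvent_nonneg hθ s₀ s)

theorem continuousOn_visitation (G : MultiAgentMDP n S A) (s : S) :
    ContinuousOn (fun θ => G.visitation θ s) (jointPolicies S A) := by
  have h : ContinuousOn (fun θ => (1 - G.γ) * G.occupation θ s) (jointPolicies S A) := fun θ hθ =>
    ((G.continuousAt_occupation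
      (G.jointPolicies_subset_contracting hθ) s).const_mul _).continuousWithinAt
  exact h.congr fun θ hθ => G.visitation_eq_occupation (G.jointPolicies_subset_contracting hθ) s

/-- The ratios form a finite union of continuous images of the compact set `X × X`. -/
theorem isGreatest_mismatch (G : MultiAgentMDP n S A)
    (hpos : ∀ θ ∈ jointPolicies S A, ∀ s, 0 < G.visitation θ s)
    (hne : (jointPolicies S A).Nonempty) : IsGreatest G.visitationRatios G.mismatch := by
  have heq : G.visitationRatios = ⋃ s : S,
      (fun p : PolicyParam S A × PolicyParam S A => G.visitation p.1 s / G.visitation p.2 s) ''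
        (jointPolicies S A ×ˢ jointPolicies S A) := by
    ext x
    simp only [visitationRatios, Set.mem_ofPred_eq, Set.mem_iUnion, Set.mem_image, Set.mem_prod,
      Prod.exists]
    constructor
    · rintro ⟨θ, hθ, θ', hθ', s, rfl⟩
      exact ⟨s, θ, θ', ⟨hθ, hθ'⟩, rfl⟩
    · rintro ⟨s, θ, θ', ⟨hθ, hθ'⟩, rfl⟩
      exact ⟨θ, hθ, θ', hθ', s, rfl⟩
  refine IsCompact.isGreatest_sSup ?_ ?_
  · rw [heq]
    refine isCompact_iUnion fun s =>
      (isCompact_jointPolicies.prod isCompact_jointPolicies).image_of_continuousOn ?_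
    refine ContinuousOn.div ?_ ?_ fun p hp => (hpos _ hp.2 s).ne'
    · exact (G.continuousOn_visitation s).comp continuousOn_fst fun p hp => hp.1
    · exact (G.continuousOn_visitation s).comp continuousOn_snd fun p hp => hp.2
  · obtain ⟨θ, hθ⟩ := hne
    obtain ⟨s⟩ := G.nonempty_state
    exact ⟨_, θ, hθ, θ, hθ, s, rfl⟩

theorem totalPotential_update_sub_eq (G : MultiAgentMDP n S A) {φ : S → (∀ i, A i) → ℝ}
    (hφ : G.IsMarkovPotential φ) {θ : PolicyParam S A} (hθ : θ ∈ jointPolicies S A) {k : Fin n}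
    {x : EuclideanSpace ℝ (S × A k)} (hx : x ∈ agentPolicies S A k) :
    G.totalPotential φ (Function.update θ k x) - G.totalPotential φ θ
      = G.totalPotential (G.r k) (Function.update θ k x) - G.totalPotential (G.r k) θ := by
  unfold totalPotential
  rw [← Finset.sum_sub_distrib, ← Finset.sum_sub_distrib]
  refine Finset.sum_congr rfl fun s _ => ?_
  rw [← mul_sub, ← mul_sub, ← hφ k θ hθ x hx s]
  rfl

/-- Quadratic lower bound for the potential when the agents in `F` switch from `θ` to `θ'`. -/
theorem le_totalPotential_piecewise_sub (G : MultiAgentMDP n S A) {φ : S → (∀ i, A i) → ℝ}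
    (hφ : G.IsMarkovPotential φ) {θ θ' : PolicyParam S A} (hθ : θ ∈ jointPolicies S A)
    (hθ' : θ' ∈ jointPolicies S A) {δ : Fin n → ℝ} (hδ0 : ∀ i, 0 ≤ δ i)
    (hδ : ∀ i s, ∑ b, |θ' i (s, b) - θ i (s, b)| ≤ δ i) (F : Finset (Fin n)) :
    ∑ k ∈ F, G.gradForm (G.r k) k θ θ (θ' k - θ k) - (∑ k ∈ F, δ k) ^ 2 / (1 - G.γ) ^ 3
      ≤ G.totalPotential φ (F.piecewise θ' θ) - G.totalPotential φ θ := by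
  have hγ : 0 < 1 - G.γ := sub_pos.2 G.γ_mem.2
  have hmem : ∀ F : Finset (Fin n), F.piecewise θ' θ ∈ jointPolicies S A := by
    intro F i
    by_cases h : i ∈ F
    · simpa [h] using hθ' i
    · simpa [h] using hθ i
  have hdiff : ∀ (F : Finset (Fin n)) (i : Fin n) (s : S),
      ∑ b, |F.piecewise θ' θ i (s, b) - θ i (s, b)| ≤ if i ∈ F then δ i else 0 := by
    intro F i s
    by_cases h : i ∈ F
    · simpa [h] using hδ i s
    · simp [h]
  induction F using Finset.induction_on with
  | empty => simp
  | insert k F hk ih =>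
    have hm := hmem (insert k F)
    have hd := hdiff (insert k F)
    have hs : F.piecewise θ' θ k = θ k := by simp [hk]
    -- When `k` moves after `F`, the occupation measure belongs to the hybrid of `insert k F` and
    -- the action values to that of `F`.
    have hB := G.abs_gradForm_sub_le (G.abs_r_le_one k) (jointPolicies_subset_subPolicies hm)
      (jointPolicies_subset_subPolicies (hmem F)) (jointPolicies_subset_subPolicies hθ) hd (hdiff F)
      (hδ0 k) (u := θ' k - θ k) (hδ k)
    rw [Finset.piecewise_insert] at hm hB ⊢
    have h1 := G.totalPotential_update_sub_eq hφ (hmem F) (hθ' k)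
    rw [G.totalPotential_update_sub (G.r k) (G.jointPolicies_subset_contracting (hmem F))
      (G.jointPolicies_subset_contracting hm), hs] at h1
    simp only [Finset.sum_ite_mem, Finset.univ_inter] at hB
    rw [Finset.sum_insert hk] at hB
    rw [Finset.sum_insert hk, Finset.sum_insert hk]
    have hF : 0 ≤ ∑ i ∈ F, δ i := Finset.sum_nonneg fun i _ => hδ0 i
    -- With `D` the sum over `F`, `γ ≤ 1` bounds the numerator by `δ (δ + D) + δ D = (δ + D)² - D²`,
    -- so the errors telescope to a square.
    have hle : δ k * (G.γ * (δ k + ∑ i ∈ F, δ i) + ∑ i ∈ F, δ i) / (1 - G.γ) ^ 3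
        ≤ (δ k + ∑ i ∈ F, δ i) ^ 2 / (1 - G.γ) ^ 3 - (∑ i ∈ F, δ i) ^ 2 / (1 - G.γ) ^ 3 := by
      rw [← sub_div]
      refine div_le_div_of_nonneg_right ?_ (by positivity)
      have h3 : G.γ * (δ k * (δ k + ∑ i ∈ F, δ i)) ≤ 1 * (δ k * (δ k + ∑ i ∈ F, δ i)) :=
        mul_le_mul_of_nonneg_right G.γ_mem.2.le
          (mul_nonneg (hδ0 k) (add_nonneg (hδ0 k) hF))
      nlinarith [h3]
    have h4 := (abs_le.1 (hB.trans hle)).1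
    linarith

theorem gradForm_sub (G : MultiAgentMDP n S A) (f : S → (∀ i, A i) → ℝ) (k : Fin n)
    (θ'' θ' : PolicyParam S A) (u v : EuclideanSpace ℝ (S × A k)) :
    G.gradForm f k θ'' θ' (u - v) = G.gradForm f k θ'' θ' u - G.gradForm f k θ'' θ' v := by
  simp only [gradForm_eq_sum, map_sub, mul_sub, Finset.sum_sub_distrib]

/-- Gradient domination: the gain of a unilateral deviation is controlled by the best
first-order gain. -/
theorem totalPotential_update_sub_le (G : MultiAgentMDP n S A) (f : S → (∀ i, A i) → ℝ)
    {k : Fin n} {θ : PolicyParam S A} (hθ : θ ∈ jointPolicies S A)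
    {x : EuclideanSpace ℝ (S × A k)} (hx : x ∈ agentPolicies S A k) {M B : ℝ} (hM : 0 ≤ M)
    (hocc : ∀ s, G.occupation (Function.update θ k x) s ≤ M * G.occupation θ s)
    (hB : ∀ y ∈ agentPolicies S A k, G.gradForm f k θ θ (y - θ k) ≤ B) :
    G.totalPotential f (Function.update θ k x) - G.totalPotential f θ ≤ M * B := by
  have hmax : ∀ s, ∃ y ∈ agentPolicies S A k, IsMaxOn
      (G.bellmanCLM f k θ (G.value f θ) s) (agentPolicies S A k) y := fun s =>
    (isCompact_agentPolicies k).exists_isMaxOn ⟨x, hx⟩ (ContinuousLinearMap.continuous _).continuousOn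
  choose y hy hymax using hmax
  -- Glue the maximizers: row `s` of `z` is row `s` of `y s`, so `z` is optimal at all states
  -- simultaneously.
  let z : EuclideanSpace ℝ (S × A k) := WithLp.toLp 2 fun p => y p.1 p
  have hz : z ∈ agentPolicies S A k := fun s => hy s s
  have hzmax : ∀ s, ∀ w ∈ agentPolicies S A k,
      G.bellmanCLM f k θ (G.value f θ) s w ≤ G.bellmanCLM f k θ (G.value f θ) s z := by
    intro s w hw
    rw [G.bellmanCLM_congr f k θ (G.value f θ) s (x := z) (y := y s) fun b => rfl]
    exact hymax s hw
  rw [G.totalPotential_update_sub f (G.jointPolicies_subset_contracting hθ)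
    (G.jointPolicies_subset_contracting (update_mem_jointPolicies hθ hx))]
  refine le_trans ?_ (mul_le_mul_of_nonneg_left (hB z hz) hM)
  rw [gradForm_eq_sum, gradForm_eq_sum, Finset.mul_sum]
  refine Finset.sum_le_sum fun s _ => ?_
  -- Nonnegativity at every state is what permits replacing the occupation weights by the larger `M
  -- * occupation θ s`.
  have h0 : 0 ≤ G.bellmanCLM f k θ (G.value f θ) s (z - θ k) := by
    rw [map_sub]; exact sub_nonneg.2 (hzmax s _ (hθ k))
  calc _ ≤ G.occupation (Function.update θ k x) s
          * G.bellmanCLM f k θ (G.value f θ) s (z - θ k) := by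
        refine mul_le_mul_of_nonneg_left ?_
          (G.occupation_nonneg (update_mem_jointPolicies hθ hx) s)
        rw [map_sub, map_sub]
        exact sub_le_sub_right (hzmax s x hx) _
    _ ≤ _ := by
        rw [← mul_assoc]
        exact mul_le_mul_of_nonneg_right (hocc s) h0

/-! ### Estimates along gradient play. -/

theorem gradientPlay_mem (G : MultiAgentMDP n S A) (η : ℝ) {θ₀ : PolicyParam S A}
    (hθ₀ : θ₀ ∈ jointPolicies S A) (t : ℕ) : G.gradientPlay η θ₀ t ∈ jointPolicies S A := by
  cases t with
  | zero => exact hθ₀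
  | succ t =>
    exact fun i => (euclideanProj_spec ⟨_, hθ₀ i⟩ (isCompact_agentPolicies i).isComplete
      (convex_agentPolicies i) _).1

/-- The variational inequality satisfied by a step of gradient play. -/
theorem gradForm_le_inner_of_gradientPlay (G : MultiAgentMDP n S A) {β : ℝ} (hβ : 0 < β)
    {θ₀ : PolicyParam S A} (hθ₀ : θ₀ ∈ jointPolicies S A) (t : ℕ) (k : Fin n)
    {w : EuclideanSpace ℝ (S × A k)} (hw : w ∈ agentPolicies S A k) :
    G.gradForm (G.r k) k (G.gradientPlay (1 / β) θ₀ t) (G.gradientPlay (1 / β) θ₀ t)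
        (w - G.gradientPlay (1 / β) θ₀ (t + 1) k)
      ≤ β * inner ℝ (G.gradientPlay (1 / β) θ₀ (t + 1) k - G.gradientPlay (1 / β) θ₀ t k)
          (w - G.gradientPlay (1 / β) θ₀ (t + 1) k) := by
  rw [← G.inner_policyGradient (G.jointPolicies_subset_contracting (G.gradientPlay_mem _ hθ₀ t))]
  -- Obtuse-angle criterion at the projected point; multiplying by `β`, the inverse step size,
  -- isolates the gradient term.
  have h := inner_sub_euclideanProj_nonpos ⟨_, hθ₀ k⟩ (isCompact_agentPolicies k).isComplete
    (convex_agentPolicies k) (G.gradientPlay (1 / β) θ₀ t k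
      + (1 / β) • G.policyGradient (G.gradientPlay (1 / β) θ₀ t) k) hw
  change inner ℝ (_ - G.gradientPlay (1 / β) θ₀ (t + 1) k)
    (w - G.gradientPlay (1 / β) θ₀ (t + 1) k) ≤ 0 at h
  rw [add_sub_right_comm, inner_add_left, real_inner_smul_left,
    ← neg_sub (G.gradientPlay (1 / β) θ₀ (t + 1) k), inner_neg_left] at h
  have h2 := mul_le_mul_of_nonneg_left h hβ.le
  rw [mul_add, ← mul_assoc, mul_one_div_cancel hβ.ne'] at h2
  linarith

/-- The projection inequality tested at the old iterate gives first-order gain at least `β *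
sqDist`. By Cauchy–Schwarz over states' rows and over agents, the quadratic loss is at most `(∑ |A
i|) / (1 - γ)³ * sqDist`, which is `β / 2 * sqDist` by the choice of `β`. -/
theorem gradientPlay_ascent (G : MultiAgentMDP n S A) {φ : S → (∀ i, A i) → ℝ}
    (hφ : G.IsMarkovPotential φ) {θ₀ : PolicyParam S A} (hθ₀ : θ₀ ∈ jointPolicies S A)
    {β : ℝ} (hβ0 : 0 < β) (hβ : β = 2 / (1 - G.γ) ^ 3 * ∑ i, (Fintype.card (A i) : ℝ)) (t : ℕ) :
    β / 2 * sqDist (G.gradientPlay (1 / β) θ₀ (t + 1)) (G.gradientPlay (1 / β) θ₀ t)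
      ≤ G.totalPotential φ (G.gradientPlay (1 / β) θ₀ (t + 1))
        - G.totalPotential φ (G.gradientPlay (1 / β) θ₀ t) := by
  have hγ : 0 < 1 - G.γ := sub_pos.2 G.γ_mem.2
  have hmem := G.gradientPlay_mem (1 / β) hθ₀ t
  have hmem' := G.gradientPlay_mem (1 / β) hθ₀ (t + 1)
  have hVI := fun k => G.gradForm_le_inner_of_gradientPlay hβ0 hθ₀ t k (hmem k)
  set θ := G.gradientPlay (1 / β) θ₀ t
  set θ' := G.gradientPlay (1 / β) θ₀ (t + 1)
  have h1 := G.le_totalPotential_piecewise_sub hφ hmem hmem'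
    (δ := fun i => √(Fintype.card (A i)) * ‖θ' i - θ i‖) (fun i => by positivity)
    (fun i s => sum_abs_le_sqrt_card_mul_norm (θ' i - θ i) s) Finset.univ
  rw [Finset.piecewise_univ] at h1
  have h2 : β * sqDist θ' θ ≤ ∑ k, G.gradForm (G.r k) k θ θ (θ' k - θ k) := by
    rw [sqDist, Finset.mul_sum]
    refine Finset.sum_le_sum fun k _ => ?_
    have h := hVI k
    rw [← neg_sub (θ' k) (θ k), inner_neg_right, real_inner_self_eq_norm_sq,
      ← neg_one_smul ℝ (θ' k - θ k), gradForm_smul] at h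
    linarith
  have h3 : (∑ i, √(Fintype.card (A i)) * ‖θ' i - θ i‖) ^ 2 / (1 - G.γ) ^ 3
      ≤ β / 2 * sqDist θ' θ := by
    rw [div_le_iff₀ (by positivity)]
    refine (sq_sum_sqrt_card_mul_norm_le θ' θ).trans (le_of_eq ?_)
    rw [hβ]
    field_simp
  linarith

/-- The first-order gain at the new iterate is that of the old gradient, controlled by the
projection inequality and the diameter `2 √|S|` of the feasible region, plus the change of gradient
along the step. Each part contributes `2 β √|S|` times the step length. -/
theorem NEGap_gradientPlay_le (G : MultiAgentMDP n S A) {θ₀ : PolicyParam S A}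
    (hθ₀ : θ₀ ∈ jointPolicies S A) {β : ℝ} (hβ0 : 0 < β)
    (hβ : β = 2 / (1 - G.γ) ^ 3 * ∑ i, (Fintype.card (A i) : ℝ))
    (hcard : 1 ≤ ∑ i, (Fintype.card (A i) : ℝ)) {M : ℝ} (hM : 0 ≤ M)
    (hocc : ∀ θ ∈ jointPolicies S A, ∀ θ' ∈ jointPolicies S A, ∀ s,
      G.occupation θ s ≤ M * G.occupation θ' s) (t : ℕ) :
    G.NEGap (G.gradientPlay (1 / β) θ₀ (t + 1))
      ≤ 4 * M * β * √(Fintype.card S)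
        * √(sqDist (G.gradientPlay (1 / β) θ₀ (t + 1)) (G.gradientPlay (1 / β) θ₀ t)) := by
  refine Real.iSup_le (fun k => ?_) (by positivity)
  have hγ : 0 < 1 - G.γ := sub_pos.2 G.γ_mem.2
  have hmem := G.gradientPlay_mem (1 / β) hθ₀ t
  have hmem' := G.gradientPlay_mem (1 / β) hθ₀ (t + 1)
  have hVI := fun w hw => G.gradForm_le_inner_of_gradientPlay hβ0 hθ₀ t k (w := w) hw
  set θ := G.gradientPlay (1 / β) θ₀ t
  set θ' := G.gradientPlay (1 / β) θ₀ (t + 1)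
  set C := ∑ i, (Fintype.card (A i) : ℝ)
  have hB : ∀ y ∈ agentPolicies S A k, G.gradForm (G.r k) k θ' θ' (y - θ' k)
      ≤ 4 * β * √(Fintype.card S) * √(sqDist θ' θ) := by
    intro y hy
    have hδ : ∀ i s, ∑ b, |θ' i (s, b) - θ i (s, b)| ≤ √(Fintype.card (A i)) * ‖θ' i - θ i‖ :=
      fun i s => sum_abs_le_sqrt_card_mul_norm (θ' i - θ i) s
    -- The factor 2 is the ℓ¹ bound on each row of a difference of two policies.
    have h1 := (abs_le.1 (G.abs_gradForm_sub_le (G.abs_r_le_one k)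
      (jointPolicies_subset_subPolicies hmem') (jointPolicies_subset_subPolicies hmem')
      (jointPolicies_subset_subPolicies hmem) hδ hδ zero_le_two
      (sum_abs_sub_le_two hy (hmem' k)))).2
    have hS : 1 ≤ √(Fintype.card S : ℝ) := by
      have := G.nonempty_state
      rw [Real.one_le_sqrt]
      exact_mod_cast Fintype.card_pos
    have hD : ∑ i, √(Fintype.card (A i)) * ‖θ' i - θ i‖ ≤ C * √(sqDist θ' θ) := by
      refine (Real.le_sqrt_of_sq_le (sq_sum_sqrt_card_mul_norm_le θ' θ)).trans ?_
      rw [Real.sqrt_mul (by positivity)]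
      gcongr
      -- `√C ≤ C` because `1 ≤ C`.
      exact Real.sqrt_le_iff.2 ⟨by positivity, by nlinarith⟩
    have hD0 : 0 ≤ ∑ i, √(Fintype.card (A i)) * ‖θ' i - θ i‖ := by positivity
    have h2 : 2 * (G.γ * (∑ i, √(Fintype.card (A i)) * ‖θ' i - θ i‖)
          + ∑ i, √(Fintype.card (A i)) * ‖θ' i - θ i‖) / (1 - G.γ) ^ 3
        ≤ 2 * β * √(Fintype.card S) * √(sqDist θ' θ) := by
      calc _ ≤ 2 * (1 * (C * √(sqDist θ' θ)) + C * √(sqDist θ' θ)) / (1 - G.γ) ^ 3 := by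
            gcongr
            exact G.γ_mem.2.le
        _ = 2 * β * 1 * √(sqDist θ' θ) := by rw [hβ]; field_simp; ring
        _ ≤ _ := by gcongr
    have hle : ‖θ' k - θ k‖ ≤ √(sqDist θ' θ) :=
      Real.le_sqrt_of_sq_le (Finset.single_le_sum (f := fun i => ‖θ' i - θ i‖ ^ 2)
        (fun i _ => by positivity) (Finset.mem_univ k))
    have h3 : β * inner ℝ (θ' k - θ k) (y - θ' k)
        ≤ 2 * β * √(Fintype.card S) * √(sqDist θ' θ) := by
      calc _ ≤ β * (√(sqDist θ' θ) * (2 * √(Fintype.card S))) := by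
            gcongr
            refine (real_inner_le_norm _ _).trans ?_
            gcongr
            exact norm_sub_le_of_mem_agentPolicies hy (hmem' k)
        _ = _ := by ring
    have h4 := hVI y hy
    linarith
  rw [agentNEGap, sub_le_iff_le_add]
  refine csSup_le ⟨_, θ' k, hmem' k, rfl⟩ ?_
  rintro _ ⟨x, hx, rfl⟩
  have h := G.totalPotential_update_sub_le (G.r k) hmem' hx hM
    (hocc _ (update_mem_jointPolicies hmem' hx) _ hmem') hB
  change G.totalPotential (G.r k) (Function.update θ' k x) ≤ _ + G.totalPotential (G.r k) θ'
  linarith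

end MultiAgentMDP

/-! ### Averaging over the steps. -/

theorem mainTheorem3 {n : ℕ} {S : Type*} {A : Fin n → Type*} [Fintype S] [DecidableEq S]
    [∀ i, Fintype (A i)]
    (G : MultiAgentMDP n S A)
    (hpos : ∀ θ ∈ jointPolicies S A, ∀ s, 0 < G.visitation θ s)
    (φ : S → (∀ i, A i) → ℝ) (hφ : G.IsMarkovPotential φ)
    (Φmin Φmax : ℝ)
    (hΦ : ∀ θ ∈ jointPolicies S A,
      Φmin ≤ G.totalPotential φ θ ∧ G.totalPotential φ θ ≤ Φmax)
    (θ₀ : PolicyParam S A) (hθ₀ : θ₀ ∈ jointPolicies S A)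
    (β : ℝ) (hβ : β = 2 / (1 - G.γ) ^ 3 * ∑ i, (Fintype.card (A i) : ℝ)) :
    IsGreatest G.visitationRatios G.mismatch ∧
    ∀ ε : ℝ, 0 < ε → ∀ T : ℕ, 1 ≤ T →
      64 * G.mismatch ^ 2 * (Φmax - Φmin) * (Fintype.card S : ℝ)
          * (∑ i, (Fintype.card (A i) : ℝ)) / ((1 - G.γ) ^ 3 * ε ^ 2) ≤ (T : ℝ) →
      ∃ t ∈ Finset.Icc 1 T, G.NEGap (G.gradientPlay (1 / β) θ₀ t) ≤ ε := by
  have hM := G.isGreatest_mismatch hpos ⟨θ₀, hθ₀⟩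
  refine ⟨hM, fun ε hε T hT hTε => ?_⟩
  have hγ : 0 < 1 - G.γ := sub_pos.2 G.γ_mem.2
  -- Without agents `β = 0`, but the gap is a supremum over the empty type, which is 0 in `ℝ`.
  rcases isEmpty_or_nonempty (Fin n) with hn | ⟨⟨k⟩⟩
  · refine ⟨1, Finset.mem_Icc.2 ⟨le_rfl, hT⟩, ?_⟩
    rw [MultiAgentMDP.NEGap, Real.iSup_of_isEmpty]
    exact hε.le
  have hcard : 1 ≤ ∑ i, (Fintype.card (A i) : ℝ) := by
    obtain ⟨s⟩ := G.nonempty_state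
    have hne : Nonempty (A k) := by
      by_contra h
      have : IsEmpty (A k) := not_nonempty_iff.1 h
      have h1 := (hθ₀ k s).2
      simp at h1
    calc (1 : ℝ) ≤ Fintype.card (A k) := by exact_mod_cast Fintype.card_pos
      _ ≤ _ := Finset.single_le_sum (f := fun i => (Fintype.card (A i) : ℝ))
          (fun i _ => Nat.cast_nonneg _) (Finset.mem_univ k)
  have hβ0 : 0 < β := by
    rw [hβ]
    have : 0 < ∑ i, (Fintype.card (A i) : ℝ) := by linarith
    positivity
  have hocc : ∀ θ ∈ jointPolicies S A, ∀ θ' ∈ jointPolicies S A, ∀ s,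
      G.occupation θ s ≤ G.mismatch * G.occupation θ' s := by
    intro θ hθ θ' hθ' s
    have h := hM.2 ⟨θ, hθ, θ', hθ', s, rfl⟩
    rw [div_le_iff₀ (hpos θ' hθ' s),
      G.visitation_eq_occupation (G.jointPolicies_subset_contracting hθ),
      G.visitation_eq_occupation (G.jointPolicies_subset_contracting hθ'),
      mul_left_comm] at h
    exact le_of_mul_le_mul_left h hγ
  have hM0 : 0 ≤ G.mismatch := by
    obtain ⟨θ, hθ, θ', hθ', s, h⟩ := hM.1
    rw [h]
    exact (div_pos (hpos θ hθ s) (hpos θ' hθ' s)).le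
  set E : ℕ → ℝ := fun t => MultiAgentMDP.sqDist (G.gradientPlay (1 / β) θ₀ (t + 1))
    (G.gradientPlay (1 / β) θ₀ t) with hE
  have hT0 : (0 : ℝ) < T := by exact_mod_cast hT
  -- Some squared step is at most the average of the telescoped ascent bound.
  obtain ⟨t, ht, hEt⟩ : ∃ t ∈ Finset.range T, E t ≤ 2 * (Φmax - Φmin) / (β * T) := by
    refine Finset.exists_le_of_sum_le ⟨0, Finset.mem_range.2 hT⟩ ?_
    have h1 : ∑ t ∈ Finset.range T, β / 2 * E t
        ≤ G.totalPotential φ (G.gradientPlay (1 / β) θ₀ T)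
          - G.totalPotential φ (G.gradientPlay (1 / β) θ₀ 0) := by
      rw [← Finset.sum_range_sub fun t => G.totalPotential φ (G.gradientPlay (1 / β) θ₀ t)]
      exact Finset.sum_le_sum fun t _ => G.gradientPlay_ascent hφ hθ₀ hβ0 hβ t
    rw [← Finset.mul_sum] at h1
    have h2 := (hΦ _ (G.gradientPlay_mem (1 / β) hθ₀ T)).2
    have h3 := (hΦ _ (G.gradientPlay_mem (1 / β) hθ₀ 0)).1
    rw [Finset.sum_const, Finset.card_range, nsmul_eq_mul]
    calc ∑ t ∈ Finset.range T, E t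
        = 2 / β * (β / 2 * ∑ t ∈ Finset.range T, E t) := by field_simp
      _ ≤ 2 / β * (Φmax - Φmin) := by gcongr; linarith
      _ = _ := by field_simp
  -- Step `t` controls the gap at its endpoint, so indices in `0, …, T - 1` give iterates in `1, …,
  -- T`.
  refine ⟨t + 1, Finset.mem_Icc.2 ⟨by omega, Finset.mem_range.1 ht⟩, ?_⟩
  refine (G.NEGap_gradientPlay_le hθ₀ hβ0 hβ hcard hM0 hocc t).trans ?_
  have hE0 : 0 ≤ E t := Finset.sum_nonneg fun i _ => by positivity
  refine abs_le_of_sq_le_sq' ?_ hε.le |>.2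
  rw [mul_pow, mul_pow, Real.sq_sqrt hE0, Real.sq_sqrt (Nat.cast_nonneg _)]
  rw [div_le_iff₀ (by positivity)] at hTε
  calc _ ≤ (4 * G.mismatch * β) ^ 2 * (Fintype.card S) * (2 * (Φmax - Φmin) / (β * T)) := by
        gcongr
    _ = 64 * G.mismatch ^ 2 * (Φmax - Φmin) * (Fintype.card S : ℝ)
          * (∑ i, (Fintype.card (A i) : ℝ)) / ((1 - G.γ) ^ 3 * T) := by
        -- After squaring, the bound is `32 M² β |S| (Φmax - Φmin) / T`; this relation turns it into
        -- the constant 64.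
        have e : β * (1 - G.γ) ^ 3 = 2 * ∑ i, (Fintype.card (A i) : ℝ) := by
          rw [hβ]; field_simp
        rw [eq_div_iff (by positivity)]
        field_simp
        linear_combination (32 * G.mismatch ^ 2 * (Φmax - Φmin) * (Fintype.card S : ℝ)) * e
    _ ≤ ε ^ 2 := by
        rw [div_le_iff₀ (by positivity)]
        linarith
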